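/- A virtual link diagram is a generic immersion of finitely many oriented circles, with labelled components, in the plane, each of whose double points is either a classical crossing (with over/under information) or a virtual crossing. Welded Reidemeister moves are planar isotopy, the Reidemeister moves R1, R2, R3, the virtual moves VR1, VR2, VR3 (their analogues with all crossings virtual), VR4 (a strand with two virtual crossings slides past a classical crossing) and OC (a strand that lies over two other strands slides past the virtual crossing of these two). Two local moves on virtual link diagrams are called equivalent if each application of either move is realized by a finite sequence of applications of the other move, in both directions, and welded Reidemeister moves. Let $n$ be a positive integer. The $V^n$-move is the local move that replaces, in a disk, two parallel strands without crossings, oriented in the same direction, by the tangle of the two strands that consists of $n$ consecutive identical blocks, each block being a classical crossing followed by a virtual crossing (so that the same strand is the overpass at all $n$ classical crossings). The $\overline{V}^n$-move is the same local move with the two strands oriented in opposite directions. Then the $V^n$-move and the $\overline{V}^n$-move are equivalent, whichever of the two crossing types is used for the classical crossings and whichever of the admissible orientations the two strands have, independently for the two moves. -/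

import Mathlib

/-!
Virtual link diagrams in the plane, welded Reidemeister moves, and the local moves `V^n`.

A diagram in general position with respect to the height function of the plane is cut by
horizontal lines into slices, each of which holds exactly one crossing, one local minimum (cup) or
one local maximum (cap), besides vertical strands. Slices are listed from the bottom to the top,
strands from the left to the right. Planar isotopy of diagrams is generated by the moves of
`PlanarIsotopy`.
-/

namespace Welded

universe u

/-- A strand where it meets a horizontal line: its direction there (upwards or downwards), and the
label of the component it belongs to. -/
structure Strand (ι : Type u) where
  up : Bool
  label : ι

/-- The same component, traversed in the opposite vertical direction. -/
def Strand.rev {ι : Type u} (x : Strand ι) : Strand ι := ⟨!x.up, x.label⟩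

/-- The kinds of crossings. Of the two strands of a crossing, call *first* the one that joins the
bottom left to the top right. In a classical crossing of kind `over` (`under`) the first strand is
the overpass (underpass); `virt` is a virtual crossing. -/
inductive Kind where
  | over
  | under
  | virt

/-- The same crossing, described from the point of view of the other strand. -/
def Kind.flip : Kind → Kind
  | .over => .under
  | .under => .over
  | .virt => .virt

/-- Classical crossings are those that are not virtual. -/
def Kind.IsClassical : Kind → Prop
  | .over => True
  | .under => True
  | .virt => False

/-- The elementary pieces of a diagram:
* `cross c x y`: a crossing of kind `c`, at which `x` goes from the bottom left to the top right
  and `y` from the bottom right to the top left;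
* `cup x`: a local minimum, with left leg `x` and right leg `x.rev`;
* `cap x`: a local maximum, with left leg `x` and right leg `x.rev`.
(The words "goes from ... to" refer to the position only; the orientation of `x` is `x.up`.) -/
inductive Piece (ι : Type u) where
  | cross (c : Kind) (x y : Strand ι)
  | cup (x : Strand ι)
  | cap (x : Strand ι)

/-- The strands at the bottom of a piece. -/
def Piece.bot {ι : Type u} : Piece ι → List (Strand ι)
  | .cross _ x y => [x, y]
  | .cup _ => []
  | .cap x => [x, x.rev]

/-- The strands at the top of a piece. -/
def Piece.top {ι : Type u} : Piece ι → List (Strand ι)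
  | .cross _ x y => [y, x]
  | .cup x => [x, x.rev]
  | .cap _ => []

/-- A horizontal slice of a diagram: vertical strands `left`, a piece, vertical strands `right`. -/
structure Slice (ι : Type u) where
  left : List (Strand ι)
  piece : Piece ι
  right : List (Strand ι)

/-- The strands at the bottom of a slice. -/
def Slice.bot {ι : Type u} (s : Slice ι) : List (Strand ι) := s.left ++ s.piece.bot ++ s.right

/-- The strands at the top of a slice. -/
def Slice.top {ι : Type u} (s : Slice ι) : List (Strand ι) := s.left ++ s.piece.top ++ s.right

/-- `IsTangle A w B`: the slices in the list `w`, stacked upwards, fit together to an oriented and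
labelled tangle diagram with bottom boundary `A` and top boundary `B`. -/
def IsTangle {ι : Type u} : List (Strand ι) → List (Slice ι) → List (Strand ι) → Prop
  | A, [], B => A = B
  | A, s :: w, B => s.bot = A ∧ IsTangle s.top w B

/-- An oriented virtual link diagram whose components (closed curves) carry labels in `ι`.
An ordered diagram with `μ` components is one with labels in `Fin μ` in which every label is used
for exactly one component. (Every move below keeps the labels, and the number of components with
each label.) -/
structure Diagram (ι : Type u) where
  slices : List (Slice ι)
  closed : IsTangle [] slices []

/-- A local move is a relation between tangle diagrams in a disk (drawn as stacks of slices, together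
with the vertical strands to the left and right of the disk). -/
abbrev LocalMove (ι : Type u) := List (Slice ι) → List (Slice ι) → Prop

/-- `D'` is obtained from `D` by applying the local move `M` once, from left to right: a tangle
`t` that is part of `D` is replaced by a tangle `t'`, and nothing is changed outside. -/
def Step {ι : Type u} (M : LocalMove ι) (D D' : Diagram ι) : Prop :=
  ∃ below above t t', M t t' ∧
    D.slices = below ++ t ++ above ∧ D'.slices = below ++ t' ++ above

/-- Generators of planar isotopy of diagrams. -/
inductive PlanarIsotopy {ι : Type u} : LocalMove ι
  /-- Two pieces side by side exchange their heights. -/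
  | exchange (l m r : List (Strand ι)) (p q : Piece ι) :
      PlanarIsotopy
        [⟨l, p, m ++ q.bot ++ r⟩, ⟨l ++ p.top ++ m, q, r⟩]
        [⟨l ++ p.bot ++ m, q, r⟩, ⟨l, p, m ++ q.top ++ r⟩]
  /-- A minimum and a maximum next to each other on a strand cancel. -/
  | zigzag (l r : List (Strand ι)) (x : Strand ι) :
      PlanarIsotopy [⟨l ++ [x], .cup x.rev, r⟩, ⟨l, .cap x, x :: r⟩] []
  /-- The mirror image of `zigzag`. -/
  | zagzig (l r : List (Strand ι)) (x : Strand ι) :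
      PlanarIsotopy [⟨l, .cup x, x :: r⟩, ⟨l ++ [x], .cap x.rev, r⟩] []
  /-- A crossing slides over a maximum from one leg to the other. -/
  | slideCap (l r : List (Strand ι)) (c : Kind) (x y : Strand ι) :
      PlanarIsotopy
        [⟨l, .cross c x y, x.rev :: r⟩, ⟨l ++ [y], .cap x, r⟩]
        [⟨l ++ [x], .cross c.flip y x.rev, r⟩, ⟨l, .cap x, y :: r⟩]
  /-- A crossing slides through a minimum from one leg to the other. -/
  | slideCup (l r : List (Strand ι)) (c : Kind) (x y : Strand ι) :
      PlanarIsotopy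
        [⟨l ++ [y], .cup x, r⟩, ⟨l, .cross c y x, x.rev :: r⟩]
        [⟨l, .cup x, y :: r⟩, ⟨l ++ [x], .cross c.flip x.rev y, r⟩]

/-- The crossing of a strand at height `p` with a strand at height `q` (heights over the plane), the
former being the first strand. -/
def kindOfHeights (p q : ℕ) : Kind := if q < p then .over else .under

/-- The triples of crossings (of `x` and `y`, of `x` and `z`, of `y` and `z`) for which welded
isotopy allows the third Reidemeister move on the strands `x`, `y`, `z`. -/
inductive TriangleAllowed : Kind → Kind → Kind → Prop
  /-- The move R3: three classical crossings, the three strands lying at different heights. -/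
  | R3 (p q s : ℕ) (hpq : p ≠ q) (hps : p ≠ s) (hqs : q ≠ s) :
      TriangleAllowed (kindOfHeights p q) (kindOfHeights p s) (kindOfHeights q s)
  /-- The move VR3: three virtual crossings. -/
  | VR3 : TriangleAllowed .virt .virt .virt
  /-- The move VR4: `x` crosses the other two strands virtually, these cross classically. -/
  | VR4x (c : Kind) (hc : c.IsClassical) : TriangleAllowed .virt .virt c
  /-- The move VR4: `y` crosses the other two strands virtually, these cross classically. -/
  | VR4y (c : Kind) (hc : c.IsClassical) : TriangleAllowed .virt c .virt
  /-- The move VR4: `z` crosses the other two strands virtually, these cross classically. -/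
  | VR4z (c : Kind) (hc : c.IsClassical) : TriangleAllowed c .virt .virt
  /-- The move OC: `x` lies over the other two strands, these cross virtually. -/
  | OCx : TriangleAllowed .over .over .virt
  /-- The move OC: `y` lies over the other two strands, these cross virtually. -/
  | OCy : TriangleAllowed .under .virt .over
  /-- The move OC: `z` lies over the other two strands, these cross virtually. -/
  | OCz : TriangleAllowed .virt .under .under

/-- The welded Reidemeister moves R1--R3, VR1--VR4 and OC, with planar isotopy. -/
inductive WeldedMove {ι : Type u} : LocalMove ι
  | planar (t t' : List (Slice ι)) (h : PlanarIsotopy t t') : WeldedMove t t'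
  /-- The moves R1 (`c` classical) and VR1 (`c` virtual), for a kink on the right. -/
  | kinkRight (l r : List (Strand ι)) (c : Kind) (x : Strand ι) :
      WeldedMove
        [⟨l ++ [x], .cup x, r⟩, ⟨l, .cross c x x, x.rev :: r⟩, ⟨l ++ [x], .cap x, r⟩] []
  /-- The moves R1 (`c` classical) and VR1 (`c` virtual), for a kink on the left. -/
  | kinkLeft (l r : List (Strand ι)) (c : Kind) (x : Strand ι) :
      WeldedMove
        [⟨l, .cup x.rev, x :: r⟩, ⟨l ++ [x.rev], .cross c x x, r⟩, ⟨l, .cap x.rev, x :: r⟩] []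
  /-- The moves R2 (`c` classical) and VR2 (`c` virtual). -/
  | bigon (l r : List (Strand ι)) (c : Kind) (x y : Strand ι) :
      WeldedMove [⟨l, .cross c x y, r⟩, ⟨l, .cross c.flip y x, r⟩] []
  /-- The moves R3, VR3, VR4 and OC. -/
  | triangle (l r : List (Strand ι)) (a b c : Kind) (x y z : Strand ι)
      (h : TriangleAllowed a b c) :
      WeldedMove
        [⟨l, .cross a x y, z :: r⟩, ⟨l ++ [y], .cross b x z, r⟩, ⟨l, .cross c y z, x :: r⟩]
        [⟨l ++ [x], .cross c y z, r⟩, ⟨l, .cross b x z, y :: r⟩, ⟨l ++ [z], .cross a x y, r⟩]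

/-- The tangle diagram with two strands `x` and `y` that consists of `n` blocks, each of them a
crossing of kind `c` followed by a virtual crossing. -/
def blocks {ι : Type u} (l r : List (Strand ι)) (n : ℕ) (c : Kind) (x y : Strand ι) :
    List (Slice ι) :=
  (List.replicate n [⟨l, .cross c x y, r⟩, ⟨l, .cross .virt y x, r⟩]).flatten

/-- Two vertical strands without crossings, of any components, the left one with direction `a` and
the right one with direction `b`, are replaced by `blocks`. -/
inductive BlockMove {ι : Type u} (n : ℕ) (c : Kind) (a b : Bool) : LocalMove ι
  | mk (l r : List (Strand ι)) (i j : ι) :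
      BlockMove n c a b [] (blocks l r n c ⟨a, i⟩ ⟨b, j⟩)

/-- The `V^n`-move: the two strands are oriented parallel. The kind `c` of the classical crossings
and the common direction `a` describe the possible ways to draw the move: `c` tells which strand is
the overpass, and a change of `a` amounts, after a rotation of the disk, to putting the virtual
crossing of each block before the classical one. -/
def VMove {ι : Type u} (n : ℕ) (c : Kind) (a : Bool) : LocalMove ι := BlockMove n c a a

/-- The antiparallel version of the `V^n`-move. -/
def VBarMove {ι : Type u} (n : ℕ) (c : Kind) (a : Bool) : LocalMove ι := BlockMove n c a (!a)

/-- Every application of the local move `M` to a diagram is realized by a finite sequence of welded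
Reidemeister moves and moves `M'` (all of them in both directions). -/
def Realizes {ι : Type u} (M' M : LocalMove ι) : Prop :=
  ∀ D D' : Diagram ι, Step M D D' →
    Relation.EqvGen (fun E E' => Step WeldedMove E E' ∨ Step M' E E') D D'

/-- Two local moves are equivalent if each of them is realized by the other one and welded
Reidemeister moves. -/
def MoveEquivalent {ι : Type u} (M M' : LocalMove ι) : Prop :=
  Realizes M M' ∧ Realizes M' M

end Welded

namespace Welded

variable {ι : Type*}

/-! Modulo welded moves and a move `M`, the tangle of `n` blocks is the `n`-th power of a single
block, and `M` realizes a block move as soon as this power becomes trivial (`Trivializes`,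
`realizes_blockMove`). So it suffices that triviality of the power for one classical crossing type
and one choice of directions implies it for all others.

Three symmetries generate all cases. Inverting and conjugating a block exchanges the two strands
(`blocks_swap`). Rotating the disk by a half turn reverses both strands (`blocks_reverse_both`). The
essential one reverses only the underpass (`blocks_reverse_under`): the lower strand is bent by a
minimum and a maximum so that both a block `w` and a block `w'` with the reversed strand can be
drawn. A block slides over the maximum, so `w` and `w'` agree there. They also commute, because the
same strand is the overpass in both; this is where OC enters (`block_comm`). Hence `w ^ n` and `w' ^
n` agree in front of the maximum, and triviality passes from one to the other. Pulling `w'` below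
the minimum and straightening the bent strand leaves the reversed blocks alone (`wordPow_transfer`).
-/

@[simp] theorem Strand.rev_rev (x : Strand ι) : x.rev.rev = x := by
  cases x; simp [Strand.rev]

@[simp] theorem Kind.flip_flip (c : Kind) : c.flip.flip = c := by cases c <;> rfl

/-! ### Stacking of tangles and equivalence with fixed boundary -/

theorem isTangle_append {A B : List (Strand ι)} {w v : List (Slice ι)} :
    IsTangle A (w ++ v) B ↔ ∃ C, IsTangle A w C ∧ IsTangle C v B := by
  induction w generalizing A with
  | nil => simp [IsTangle]
  | cons s w ih => simp [IsTangle, ih, and_assoc]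

theorem IsTangle.append {A B C : List (Strand ι)} {w v : List (Slice ι)}
    (hw : IsTangle A w B) (hv : IsTangle B v C) : IsTangle A (w ++ v) C :=
  isTangle_append.2 ⟨B, hw, hv⟩

theorem IsTangle.top_unique {A B C : List (Strand ι)} {w : List (Slice ι)}
    (hB : IsTangle A w B) (hC : IsTangle A w C) : B = C := by
  induction w generalizing A with
  | nil => exact Eq.trans (Eq.symm hB) hC
  | cons s w ih => exact ih hB.2 hC.2

/-- One application of a welded Reidemeister move or of `M` inside a tangle from `A` to `B`. -/
def TangleStep (M : LocalMove ι) (A B : List (Strand ι)) (w w' : List (Slice ι)) : Prop :=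
  IsTangle A w B ∧ IsTangle A w' B ∧ ∃ p q t t', (WeldedMove t t' ∨ M t t') ∧
    w = p ++ t ++ q ∧ w' = p ++ t' ++ q

/-- Tangles from `A` to `B` that are related by welded Reidemeister moves and moves `M`. -/
structure TangleEquiv (M : LocalMove ι) (A B : List (Strand ι)) (w w' : List (Slice ι)) :
    Prop where
  left : IsTangle A w B
  right : IsTangle A w' B
  rel : Relation.EqvGen (TangleStep M A B) w w'

namespace TangleEquiv

variable {M : LocalMove ι} {A B C : List (Strand ι)} {w w' w'' v v' : List (Slice ι)}

theorem refl (h : IsTangle A w B) : TangleEquiv M A B w w := ⟨h, h, .refl _⟩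

theorem symm (h : TangleEquiv M A B w w') : TangleEquiv M A B w' w :=
  ⟨h.right, h.left, h.rel.symm⟩

theorem trans (h : TangleEquiv M A B w w') (h' : TangleEquiv M A B w' w'') :
    TangleEquiv M A B w w'' := ⟨h.left, h'.right, h.rel.trans _ _ _ h'.rel⟩

instance : Trans (TangleEquiv M A B) (TangleEquiv M A B) (TangleEquiv M A B) := ⟨trans⟩

theorem of_step (h : TangleStep M A B w w') : TangleEquiv M A B w w' :=
  ⟨h.1, h.2.1, .rel _ _ h⟩

theorem of_move (h : M w w') (hw : IsTangle A w B) (hw' : IsTangle A w' B) :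
    TangleEquiv M A B w w' :=
  of_step ⟨hw, hw', [], [], w, w', .inr h, by simp, by simp⟩

theorem of_welded (h : WeldedMove w w') (hw : IsTangle A w B) (hw' : IsTangle A w' B) :
    TangleEquiv M A B w w' :=
  of_step ⟨hw, hw', [], [], w, w', .inl h, by simp, by simp⟩

/-- Equivalences are mapped along functions on words that preserve steps. -/
theorem map_rel {A' B' : List (Strand ι)} {M' : LocalMove ι} (f : List (Slice ι) → List (Slice ι))
    (hf : ∀ w w', TangleStep M A B w w' → TangleStep M' A' B' (f w) (f w'))
    (hw : IsTangle A' (f w) B') (hw' : IsTangle A' (f w') B') (h : TangleEquiv M A B w w') :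
    TangleEquiv M' A' B' (f w) (f w') := by
  refine ⟨hw, hw', ?_⟩
  have := h.rel
  clear h hw hw'
  induction this with
  | rel _ _ h => exact .rel _ _ (hf _ _ h)
  | refl => exact .refl _
  | symm _ _ _ ih => exact ih.symm
  | trans _ _ _ _ _ ih ih' => exact ih.trans _ _ _ ih'

theorem append_right (h : TangleEquiv M A B w w') (hv : IsTangle B v C) :
    TangleEquiv M A C (w ++ v) (w' ++ v) := by
  refine map_rel (· ++ v) ?_ (h.left.append hv) (h.right.append hv) h
  rintro _ _ ⟨h1, h2, p, q, t, t', ht, rfl, rfl⟩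
  exact ⟨h1.append hv, h2.append hv, p, q ++ v, t, t', ht, by simp, by simp⟩

theorem append_left (hv : IsTangle A v B) (h : TangleEquiv M B C w w') :
    TangleEquiv M A C (v ++ w) (v ++ w') := by
  refine map_rel (v ++ ·) ?_ (hv.append h.left) (hv.append h.right) h
  rintro _ _ ⟨h1, h2, p, q, t, t', ht, rfl, rfl⟩
  exact ⟨hv.append h1, hv.append h2, v ++ p, q, t, t', ht, by simp, by simp⟩

theorem cons {s : Slice ι} (hs : s.bot = A) (h : TangleEquiv M s.top B w w') :
    TangleEquiv M A B (s :: w) (s :: w') :=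
  append_left (v := [s]) ⟨hs, rfl⟩ h

end TangleEquiv

/-! ### Adding vertical strands beside a tangle -/

/-- Add vertical strands to the left and to the right of a slice. -/
def Slice.whisker (l r : List (Strand ι)) (s : Slice ι) : Slice ι :=
  ⟨l ++ s.left, s.piece, s.right ++ r⟩

theorem IsTangle.whisker {A B : List (Strand ι)} {w : List (Slice ι)} (l r : List (Strand ι))
    (h : IsTangle A w B) : IsTangle (l ++ A ++ r) (w.map (Slice.whisker l r)) (l ++ B ++ r) := by
  induction w generalizing A with
  | nil => exact congrArg (l ++ · ++ r) h
  | cons s w ih =>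
    refine ⟨?_, ?_⟩
    · simp [← h.1, Slice.bot, Slice.whisker]
    · have := ih h.2
      simpa [Slice.top, Slice.whisker] using this

theorem PlanarIsotopy.whisker {t t' : List (Slice ι)} (l r : List (Strand ι))
    (h : PlanarIsotopy t t') :
    PlanarIsotopy (t.map (Slice.whisker l r)) (t'.map (Slice.whisker l r)) := by
  cases h with
  | exchange l' m r' p q => simpa [Slice.whisker] using exchange (l ++ l') m (r' ++ r) p q
  | zigzag l' r' x => simpa [Slice.whisker] using zigzag (l ++ l') (r' ++ r) x
  | zagzig l' r' x => simpa [Slice.whisker] using zagzig (l ++ l') (r' ++ r) x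
  | slideCap l' r' c x y => simpa [Slice.whisker] using slideCap (l ++ l') (r' ++ r) c x y
  | slideCup l' r' c x y => simpa [Slice.whisker] using slideCup (l ++ l') (r' ++ r) c x y

theorem WeldedMove.whisker {t t' : List (Slice ι)} (l r : List (Strand ι))
    (h : WeldedMove t t') :
    WeldedMove (t.map (Slice.whisker l r)) (t'.map (Slice.whisker l r)) := by
  cases h with
  | planar _ _ h => exact planar _ _ (h.whisker l r)
  | kinkRight l' r' c x => simpa [Slice.whisker] using kinkRight (l ++ l') (r' ++ r) c x
  | kinkLeft l' r' c x => simpa [Slice.whisker] using kinkLeft (l ++ l') (r' ++ r) c x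
  | bigon l' r' c x y => simpa [Slice.whisker] using bigon (l ++ l') (r' ++ r) c x y
  | triangle l' r' a b c x y z h =>
    simpa [Slice.whisker] using triangle (l ++ l') (r' ++ r) a b c x y z h

theorem map_whisker_blocks (l r l' r' : List (Strand ι)) (n : ℕ) (c : Kind) (x y : Strand ι) :
    (blocks l' r' n c x y).map (Slice.whisker l r) = blocks (l ++ l') (r' ++ r) n c x y := by
  simp [blocks, List.map_flatten, Slice.whisker]

theorem BlockMove.whisker {n : ℕ} {c : Kind} {a b : Bool} {t t' : List (Slice ι)}
    (l r : List (Strand ι)) (h : BlockMove n c a b t t') :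
    BlockMove n c a b (t.map (Slice.whisker l r)) (t'.map (Slice.whisker l r)) := by
  cases h with
  | mk l' r' i j => simpa [map_whisker_blocks] using mk (l ++ l') (r' ++ r) i j

/-- Local moves that may be applied next to further vertical strands. -/
def LocalMove.Whiskers (M : LocalMove ι) : Prop :=
  ∀ l r t t', M t t' → M (t.map (Slice.whisker l r)) (t'.map (Slice.whisker l r))

/-- Locality of the moves: it allows a hypothesis about two strands to be used next to the auxiliary
strands created by minima, and finally inside an arbitrary diagram. -/
theorem TangleEquiv.whisker {M : LocalMove ι} (hM : LocalMove.Whiskers M)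
    {A B : List (Strand ι)} {w w' : List (Slice ι)} (l r : List (Strand ι))
    (h : TangleEquiv M A B w w') :
    TangleEquiv M (l ++ A ++ r) (l ++ B ++ r)
      (w.map (Slice.whisker l r)) (w'.map (Slice.whisker l r)) := by
  refine h.map_rel (List.map (Slice.whisker l r)) ?_ (h.left.whisker l r) (h.right.whisker l r)
  rintro _ _ ⟨h1, h2, p, q, t, t', ht, rfl, rfl⟩
  exact ⟨h1.whisker l r, h2.whisker l r, p.map (.whisker l r), q.map (.whisker l r), _, _,
    ht.imp (·.whisker l r) (hM l r _ _), by simp, by simp⟩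

namespace TangleEquiv

variable {M : LocalMove ι}

theorem bigon (l r : List (Strand ι)) (c : Kind) (x y : Strand ι) :
    TangleEquiv M (l ++ [x, y] ++ r) (l ++ [x, y] ++ r)
      [⟨l, .cross c x y, r⟩, ⟨l, .cross c.flip y x, r⟩] [] :=
  of_welded (.bigon l r c x y)
    (by simp [IsTangle, Slice.bot, Slice.top, Piece.bot, Piece.top]) rfl

theorem triangle (l r : List (Strand ι)) {a b c : Kind} (x y z : Strand ι)
    (h : TriangleAllowed a b c) :
    TangleEquiv M (l ++ [x, y, z] ++ r) (l ++ [z, y, x] ++ r)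
      [⟨l, .cross a x y, z :: r⟩, ⟨l ++ [y], .cross b x z, r⟩, ⟨l, .cross c y z, x :: r⟩]
      [⟨l ++ [x], .cross c y z, r⟩, ⟨l, .cross b x z, y :: r⟩, ⟨l ++ [z], .cross a x y, r⟩] :=
  of_welded (.triangle l r a b c x y z h)
    (by simp [IsTangle, Slice.bot, Slice.top, Piece.bot, Piece.top])
    (by simp [IsTangle, Slice.bot, Slice.top, Piece.bot, Piece.top])

theorem exchange (l m r : List (Strand ι)) (p q : Piece ι) :
    TangleEquiv M (l ++ p.bot ++ m ++ q.bot ++ r) (l ++ p.top ++ m ++ q.top ++ r)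
      [⟨l, p, m ++ q.bot ++ r⟩, ⟨l ++ p.top ++ m, q, r⟩]
      [⟨l ++ p.bot ++ m, q, r⟩, ⟨l, p, m ++ q.top ++ r⟩] :=
  of_welded (.planar _ _ (.exchange l m r p q))
    (by simp [IsTangle, Slice.bot, Slice.top])
    (by simp [IsTangle, Slice.bot, Slice.top])

theorem zagzig (l r : List (Strand ι)) (x : Strand ι) :
    TangleEquiv M (l ++ x :: r) (l ++ x :: r)
      [⟨l, .cup x, x :: r⟩, ⟨l ++ [x], .cap x.rev, r⟩] [] :=
  of_welded (.planar _ _ (.zagzig l r x))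
    (by simp [IsTangle, Slice.bot, Slice.top, Piece.bot, Piece.top]) rfl

theorem slideCap (l r : List (Strand ι)) (c : Kind) (x y : Strand ι) :
    TangleEquiv M (l ++ [x, y, x.rev] ++ r) (l ++ y :: r)
      [⟨l, .cross c x y, x.rev :: r⟩, ⟨l ++ [y], .cap x, r⟩]
      [⟨l ++ [x], .cross c.flip y x.rev, r⟩, ⟨l, .cap x, y :: r⟩] :=
  of_welded (.planar _ _ (.slideCap l r c x y))
    (by simp [IsTangle, Slice.bot, Slice.top, Piece.bot, Piece.top])
    (by simp [IsTangle, Slice.bot, Slice.top, Piece.bot, Piece.top])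

end TangleEquiv

/-! ### Powers of tangles: conjugation, inverses, transfer -/

/-- The word `w` repeated `n` times. -/
def wordPow (w : List (Slice ι)) (n : ℕ) : List (Slice ι) := (List.replicate n w).flatten

@[simp] theorem wordPow_zero (w : List (Slice ι)) : wordPow w 0 = [] := rfl

theorem wordPow_succ (w : List (Slice ι)) (n : ℕ) : wordPow w (n + 1) = w ++ wordPow w n := by
  simp [wordPow, List.replicate_succ]

theorem wordPow_succ' (w : List (Slice ι)) (n : ℕ) : wordPow w (n + 1) = wordPow w n ++ w := by
  simp [wordPow, List.replicate_succ']

theorem IsTangle.wordPow {A : List (Strand ι)} {w : List (Slice ι)} (h : IsTangle A w A) (n : ℕ) :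
    IsTangle A (wordPow w n) A := by
  induction n with
  | zero => rfl
  | succ n ih => rw [wordPow_succ]; exact h.append ih

namespace TangleEquiv

variable {M : LocalMove ι} {A B C : List (Strand ι)} {n : ℕ}

/-- A tangle that intertwines two tangles intertwines their powers. -/
theorem intertwine_wordPow {g w w' : List (Slice ι)} (hg : IsTangle B g A) (hw : IsTangle A w A)
    (hw' : IsTangle B w' B) (h : TangleEquiv M B A (g ++ w) (w' ++ g)) :
    TangleEquiv M B A (g ++ wordPow w n) (wordPow w' n ++ g) := by
  induction n with
  | zero => simpa using refl hg
  | succ n ih =>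
    have h1 := h.append_right (hw.wordPow n)
    have h2 := append_left hw' ih
    simpa [wordPow_succ] using h1.trans (by simpa using h2)

/-- The product of the two `n`-th powers telescopes from the middle, so a right inverse of `w` is
enough. -/
theorem wordPow_inverse {w w' : List (Slice ι)} (h : TangleEquiv M A A (w ++ w') [])
    (hw : IsTangle A w A) (hw' : IsTangle A w' A) (hn : TangleEquiv M A A (wordPow w n) []) :
    TangleEquiv M A A (wordPow w' n) [] := by
  have key : TangleEquiv M A A (wordPow w n ++ wordPow w' n) [] := by
    clear hn
    induction n with
    | zero => exact refl rfl
    | succ n ih =>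
      have h1 := append_left (hw.wordPow n) (h.append_right (hw'.wordPow n))
      rw [wordPow_succ', wordPow_succ]
      exact trans (by simpa using h1) ih
  exact (hn.append_right (hw'.wordPow n)).symm.trans key

theorem cancel_right {w e e' : List (Slice ι)} (hw : IsTangle A w A)
    (hee : TangleEquiv M A A (e ++ e') []) (he' : IsTangle B e' A)
    (h : TangleEquiv M A B (w ++ e) e) : TangleEquiv M A A w [] := by
  have h1 := append_left hw hee
  have h2 := h.append_right he'
  simp only [List.append_nil, List.append_assoc] at h1 h2
  exact h1.symm.trans (h2.trans hee)

/-- Intertwining by `g` turns the power of `w'` in front of `g` into `g` itself; the right inverse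
`g'` then removes `g`. -/
theorem wordPow_of_conj {g g' w w' : List (Slice ι)} (hg : IsTangle B g A) (hg' : IsTangle A g' B)
    (hw : IsTangle A w A) (hw' : IsTangle B w' B) (hgg : TangleEquiv M B B (g ++ g') [])
    (h : TangleEquiv M B A (g ++ w) (w' ++ g)) (hn : TangleEquiv M A A (wordPow w n) []) :
    TangleEquiv M B B (wordPow w' n) [] := by
  refine cancel_right (hw'.wordPow n) hgg hg' ?_
  refine (intertwine_wordPow hg hw hw' h).symm.trans ?_
  simpa using append_left hg hn

/-- If the tangles `w` and `w'` commute and agree in front of `g`, then a trivial power of `w` gives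
rise to a trivial power of each tangle `v` that can be pulled through `k` to become `w'`. -/
theorem wordPow_transfer {w w' v g k e e' : List (Slice ι)} {D : List (Strand ι)}
    (hw : IsTangle A w A) (hw' : IsTangle A w' A) (hv : IsTangle D v D)
    (hg : IsTangle A g B) (hk : IsTangle D k A) (he' : IsTangle B e' D)
    (hcomm : TangleEquiv M A A (w ++ w') (w' ++ w))
    (hwg : TangleEquiv M A B (w ++ g) (w' ++ g))
    (hkv : TangleEquiv M D A (k ++ w') (v ++ k))
    (hkg : TangleEquiv M D B (k ++ g) e) (hee : TangleEquiv M D D (e ++ e') [])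
    (hn : TangleEquiv M A A (wordPow w n) []) :
    TangleEquiv M D D (wordPow v n) [] := by
  -- Of `n + 1` factors `w`, the one next to `g` is turned into `w'` and moved to the bottom by
  -- commutation; the remaining `n` factors are handled by induction.
  have key : TangleEquiv M A B (wordPow w n ++ g) (wordPow w' n ++ g) := by
    clear hn
    induction n with
    | zero => exact refl hg
    | succ n ih =>
      have h1 : TangleEquiv M A B (wordPow w n ++ w ++ g) (wordPow w n ++ w' ++ g) := by
        simpa using append_left (hw.wordPow n) hwg
      have h2 := (intertwine_wordPow (n := n) hw' hw hw hcomm.symm).symm.append_right hg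
      have h3 : TangleEquiv M A B (w' ++ wordPow w n ++ g) (w' ++ (wordPow w' n ++ g)) := by
        simpa using append_left hw' ih
      rw [wordPow_succ', wordPow_succ]
      simpa using h1.trans (h2.trans h3)
  have h1 : TangleEquiv M A B (wordPow w' n ++ g) g := key.symm.trans (hn.append_right hg)
  have h2 : TangleEquiv M D B (wordPow v n ++ k ++ g) (k ++ g) :=
    ((intertwine_wordPow hk hw' hv hkv).symm.append_right hg).trans
      (by simpa using append_left hk h1)
  -- The composite of `k` and `g` reduces to `e`, which is right invertible, although neither `k`
  -- nor `g` need be.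
  refine cancel_right (hv.wordPow n) hee he' (B := B) ?_
  refine trans ?_ (h2.trans hkg)
  simpa using append_left (hv.wordPow n) hkg.symm

end TangleEquiv

attribute [simp] IsTangle Slice.bot Slice.top Piece.bot Piece.top Slice.whisker

theorem blocks_eq_wordPow (l r : List (Strand ι)) (n : ℕ) (c : Kind) (x y : Strand ι) :
    blocks l r n c x y = wordPow [⟨l, .cross c x y, r⟩, ⟨l, .cross .virt y x, r⟩] n := rfl

theorem map_whisker_wordPow (l r : List (Strand ι)) (w : List (Slice ι)) (n : ℕ) :
    (wordPow w n).map (Slice.whisker l r) = wordPow (w.map (Slice.whisker l r)) n := by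
  simp [wordPow, List.map_flatten]

/-! ### Symmetries of the two-strand block tangle -/

/-- The move `M` makes the two-strand tangle of `n` blocks with crossings of kind `c` trivial, for
strands with the directions `a` and `b`. -/
def Trivializes (M : LocalMove ι) (n : ℕ) (c : Kind) (a b : Bool) : Prop :=
  ∀ i j : ι, TangleEquiv M [⟨a, i⟩, ⟨b, j⟩] [⟨a, i⟩, ⟨b, j⟩] (blocks [] [] n c ⟨a, i⟩ ⟨b, j⟩) []

namespace TangleEquiv

variable {M : LocalMove ι} {n : ℕ}

/-- The virtual crossing of each block may be moved behind the classical one. -/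
theorem blocks_of_virt_first {c : Kind} {x y : Strand ι}
    (h : TangleEquiv M [y, x] [y, x]
      (wordPow [⟨[], .cross .virt y x, []⟩, ⟨[], .cross c x y, []⟩] n) []) :
    TangleEquiv M [x, y] [x, y] (blocks [] [] n c x y) [] :=
  -- With `g` the classical crossing, both sides of the intertwining relation are the same word:
  -- classical, virtual, classical.
  wordPow_of_conj (g := [⟨[], .cross c x y, []⟩]) (g' := [⟨[], .cross c.flip y x, []⟩])
    (by simp) (by simp) (by simp) (by simp) (bigon [] [] c x y) (refl (by simp)) h

/-- The inverse of a block is a block of the other crossing type with the strands exchanged, except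
that its virtual crossing comes first. -/
theorem blocks_swap {c : Kind} {x y : Strand ι}
    (h : TangleEquiv M [x, y] [x, y] (blocks [] [] n c x y) []) :
    TangleEquiv M [y, x] [y, x] (blocks [] [] n c.flip y x) [] := by
  apply blocks_of_virt_first
  refine wordPow_inverse ?_ (by simp) (by simp) h
  calc
    TangleEquiv M [x, y] [x, y]
      [⟨[], .cross c x y, []⟩, ⟨[], .cross .virt y x, []⟩, ⟨[], .cross .virt x y, []⟩,
        ⟨[], .cross c.flip y x, []⟩]
      [⟨[], .cross c x y, []⟩, ⟨[], .cross c.flip y x, []⟩] :=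
        .cons rfl (append_right (bigon [] [] .virt y x) (by simp))
    TangleEquiv M [x, y] [x, y] _ [] := bigon [] [] c x y

/-- Two blocks commute if the same strand is the overpass in both. -/
theorem block_comm (x y z : Strand ι) :
    TangleEquiv M [x, y, z] [x, y, z]
      [⟨[], .cross .under x y, [z]⟩, ⟨[], .cross .virt y x, [z]⟩,
        ⟨[x], .cross .over y z, []⟩, ⟨[x], .cross .virt z y, []⟩]
      [⟨[x], .cross .over y z, []⟩, ⟨[x], .cross .virt z y, []⟩,
        ⟨[], .cross .under x y, [z]⟩, ⟨[], .cross .virt y x, [z]⟩] := by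
  calc
    TangleEquiv M [x, y, z] [x, y, z]
      [⟨[], .cross .under x y, [z]⟩, ⟨[], .cross .virt y x, [z]⟩,
        ⟨[x], .cross .over y z, []⟩, ⟨[x], .cross .virt z y, []⟩]
      [⟨[], .cross .under x y, [z]⟩, ⟨[], .cross .virt y x, [z]⟩,
        ⟨[x], .cross .over y z, []⟩, ⟨[], .cross .virt x z, [y]⟩, ⟨[], .cross .virt z x, [y]⟩,
        ⟨[x], .cross .virt z y, []⟩] :=
        .cons rfl (.cons rfl (.cons rfl (append_right (bigon [] [y] .virt x z).symm (by simp))))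
    TangleEquiv M [x, y, z] [x, y, z] _
      [⟨[], .cross .under x y, [z]⟩, ⟨[y], .cross .virt x z, []⟩, ⟨[], .cross .over y z, [x]⟩,
        ⟨[z], .cross .virt y x, []⟩, ⟨[], .cross .virt z x, [y]⟩, ⟨[x], .cross .virt z y, []⟩] :=
        .cons rfl (append_right (triangle [] [] y x z (.VR4y .over trivial)) (by simp))
    -- The only use of OC: `y` lies over `x` and `z`, which cross virtually thanks to the inserted
    -- pair. The other triangle moves slide a strand whose crossings are all virtual.
    TangleEquiv M [x, y, z] [x, y, z] _
      [⟨[x], .cross .over y z, []⟩, ⟨[], .cross .virt x z, [y]⟩, ⟨[z], .cross .under x y, []⟩,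
        ⟨[z], .cross .virt y x, []⟩, ⟨[], .cross .virt z x, [y]⟩, ⟨[x], .cross .virt z y, []⟩] :=
        append_right (triangle [] [] x y z .OCy) (by simp)
    TangleEquiv M [x, y, z] [x, y, z] _
      [⟨[x], .cross .over y z, []⟩, ⟨[], .cross .virt x z, [y]⟩, ⟨[z], .cross .under x y, []⟩,
        ⟨[], .cross .virt z y, [x]⟩, ⟨[y], .cross .virt z x, []⟩, ⟨[], .cross .virt y x, [z]⟩] :=
        .cons rfl (.cons rfl (.cons rfl (triangle [] [] z y x .VR3).symm))
    TangleEquiv M [x, y, z] [x, y, z] _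
      [⟨[x], .cross .over y z, []⟩, ⟨[x], .cross .virt z y, []⟩, ⟨[], .cross .under x y, [z]⟩,
        ⟨[y], .cross .virt x z, []⟩, ⟨[y], .cross .virt z x, []⟩, ⟨[], .cross .virt y x, [z]⟩] :=
        .cons rfl (append_right (triangle [] [] x z y (.VR4y .under trivial)) (by simp))
    TangleEquiv M [x, y, z] [x, y, z] _
      [⟨[x], .cross .over y z, []⟩, ⟨[x], .cross .virt z y, []⟩,
        ⟨[], .cross .under x y, [z]⟩, ⟨[], .cross .virt y x, [z]⟩] :=
        .cons rfl (.cons rfl (.cons rfl (append_right (bigon [y] [] .virt x z) (by simp))))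

/-- A block slides over a maximum, up to virtual crossings. -/
theorem block_slideCap (c : Kind) (x y : Strand ι) :
    TangleEquiv M [x, y, x.rev] [y]
      [⟨[], .cross c x y, [x.rev]⟩, ⟨[], .cross .virt y x, [x.rev]⟩,
        ⟨[], .cross .virt x y, [x.rev]⟩, ⟨[y], .cap x, []⟩]
      [⟨[x], .cross c.flip y x.rev, []⟩, ⟨[x], .cross .virt x.rev y, []⟩,
        ⟨[], .cross .virt x y, [x.rev]⟩, ⟨[y], .cap x, []⟩] := by
  -- The extra virtual crossing below the maximum cancels the one of the block, which frees the
  -- classical crossing to slide.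
  calc
    TangleEquiv M [x, y, x.rev] [y]
      [⟨[], .cross c x y, [x.rev]⟩, ⟨[], .cross .virt y x, [x.rev]⟩,
        ⟨[], .cross .virt x y, [x.rev]⟩, ⟨[y], .cap x, []⟩]
      [⟨[], .cross c x y, [x.rev]⟩, ⟨[y], .cap x, []⟩] :=
        .cons rfl (append_right (bigon [] [x.rev] .virt y x) (by simp))
    TangleEquiv M [x, y, x.rev] [y] _
      [⟨[x], .cross c.flip y x.rev, []⟩, ⟨[], .cap x, [y]⟩] := slideCap [] [] c x y
    TangleEquiv M [x, y, x.rev] [y] _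
      [⟨[x], .cross c.flip y x.rev, []⟩, ⟨[x], .cross .virt x.rev y, []⟩,
        ⟨[x], .cross .virt y x.rev, []⟩, ⟨[], .cap x, [y]⟩] :=
        .cons rfl (append_right (bigon [x] [] .virt x.rev y).symm (by simp))
    TangleEquiv M [x, y, x.rev] [y] _
      [⟨[x], .cross c.flip y x.rev, []⟩, ⟨[x], .cross .virt x.rev y, []⟩,
        ⟨[], .cross .virt x y, [x.rev]⟩, ⟨[y], .cap x, []⟩] :=
        .cons rfl (.cons rfl (slideCap [] [] .virt x y).symm)

theorem cup_exchange_cross (c : Kind) (x y z : Strand ι) :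
    TangleEquiv M [y, z] [x, x.rev, z, y]
      [⟨[], .cup x, [y, z]⟩, ⟨[x, x.rev], .cross c y z, []⟩]
      [⟨[], .cross c y z, []⟩, ⟨[], .cup x, [z, y]⟩] :=
  exchange [] [] [] (.cup x) (.cross c y z)

/-- The strand that is the underpass at all classical crossings may be reversed. -/
theorem blocks_reverse_under (hM : LocalMove.Whiskers M) {x y : Strand ι}
    (h : TangleEquiv M [x, y] [x, y] (blocks [] [] n .under x y) []) :
    TangleEquiv M [y, x.rev] [y, x.rev] (blocks [] [] n .over y x.rev) [] := by
  have hn := whisker hM [x.rev] [x.rev] h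
  rw [blocks_eq_wordPow, map_whisker_wordPow] at hn
  -- The minimum `k` bends the lower strand, giving `x.rev, x, y, x.rev`. The hypothesis concerns
  -- the middle pair, while `w'` is a block on the last two strands. The virtual crossing in `g`
  -- brings `x` next to the right-hand `x.rev`, so that the maximum can be closed; it survives the
  -- straightening as `e`.
  refine wordPow_transfer (B := [x.rev, y]) (D := [y, x.rev])
    (k := [⟨[], .cup x.rev, [y, x.rev]⟩])
    (g := [⟨[x.rev], .cross .virt x y, [x.rev]⟩, ⟨[x.rev, y], .cap x, []⟩])
    (w' := [⟨[x.rev, x], .cross .over y x.rev, []⟩, ⟨[x.rev, x], .cross .virt x.rev y, []⟩])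
    (e := [⟨[], .cross .virt y x.rev, []⟩]) (e' := [⟨[], .cross .virt x.rev y, []⟩])
    (by simp) (by simp) (by simp) (by simp) (by simp) (by simp)
    (whisker hM [x.rev] [] (block_comm x y x.rev))
    (whisker hM [x.rev] [] (block_slideCap .under x y))
    ?_ ?_ (bigon [] [] .virt y x.rev) hn
  · calc
      TangleEquiv M [y, x.rev] [x.rev, x, y, x.rev]
        [⟨[], .cup x.rev, [y, x.rev]⟩, ⟨[x.rev, x], .cross .over y x.rev, []⟩,
          ⟨[x.rev, x], .cross .virt x.rev y, []⟩]
        [⟨[], .cross .over y x.rev, []⟩, ⟨[], .cup x.rev, [x.rev, y]⟩,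
          ⟨[x.rev, x], .cross .virt x.rev y, []⟩] := by
          simpa using append_right (cup_exchange_cross .over x.rev y x.rev)
            (v := [⟨[x.rev, x], .cross .virt x.rev y, []⟩]) (C := [x.rev, x, y, x.rev]) (by simp)
      TangleEquiv M [y, x.rev] [x.rev, x, y, x.rev] _
        [⟨[], .cross .over y x.rev, []⟩, ⟨[], .cross .virt x.rev y, []⟩,
          ⟨[], .cup x.rev, [y, x.rev]⟩] :=
          .cons rfl (by simpa using cup_exchange_cross .virt x.rev x.rev y)
  · calc
      TangleEquiv M [y, x.rev] [x.rev, y]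
        [⟨[], .cup x.rev, [y, x.rev]⟩, ⟨[x.rev], .cross .virt x y, [x.rev]⟩,
          ⟨[x.rev, y], .cap x, []⟩]
        [⟨[], .cup x.rev, [y, x.rev]⟩, ⟨[x.rev, x], .cross .virt y x.rev, []⟩,
          ⟨[x.rev], .cap x, [y]⟩] :=
          .cons rfl (by simpa [Kind.flip] using slideCap [x.rev] [] .virt x y)
      TangleEquiv M [y, x.rev] [x.rev, y] _
        [⟨[], .cross .virt y x.rev, []⟩, ⟨[], .cup x.rev, [x.rev, y]⟩, ⟨[x.rev], .cap x, [y]⟩] := by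
          simpa using append_right (cup_exchange_cross .virt x.rev y x.rev)
            (v := [⟨[x.rev], .cap x, [y]⟩]) (C := [x.rev, y]) (by simp)
      TangleEquiv M [y, x.rev] [x.rev, y] _ [⟨[], .cross .virt y x.rev, []⟩] :=
          .cons rfl (by simpa using zagzig [] [y] x.rev)

theorem cross_exchange_cross (c d : Kind) (x y s t : Strand ι) :
    TangleEquiv M [x, y, s, t] [y, x, t, s]
      [⟨[], .cross c x y, [s, t]⟩, ⟨[y, x], .cross d s t, []⟩]
      [⟨[x, y], .cross d s t, []⟩, ⟨[], .cross c x y, [t, s]⟩] :=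
  exchange [] [] [] (.cross c x y) (.cross d s t)

/-- A crossing slides over two nested maxima. -/
theorem cross_slideCaps (c : Kind) (x y : Strand ι) :
    TangleEquiv M [x, y, x.rev, y.rev] []
      [⟨[], .cross c x y, [x.rev, y.rev]⟩, ⟨[y], .cap x, [y.rev]⟩, ⟨[], .cap y, []⟩]
      [⟨[x, y], .cross c x.rev y.rev, []⟩, ⟨[x], .cap y, [x.rev]⟩, ⟨[], .cap x, []⟩] := by
  calc
    TangleEquiv M [x, y, x.rev, y.rev] []
      [⟨[], .cross c x y, [x.rev, y.rev]⟩, ⟨[y], .cap x, [y.rev]⟩, ⟨[], .cap y, []⟩]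
      [⟨[x], .cross c.flip y x.rev, [y.rev]⟩, ⟨[], .cap x, [y, y.rev]⟩, ⟨[], .cap y, []⟩] :=
        append_right (slideCap [] [y.rev] c x y) (by simp)
    TangleEquiv M [x, y, x.rev, y.rev] [] _
      [⟨[x], .cross c.flip y x.rev, [y.rev]⟩, ⟨[x, x.rev], .cap y, []⟩, ⟨[], .cap x, []⟩] :=
        .cons rfl (exchange [] [] [] (.cap x) (.cap y))
    -- The second slide flips the kind again, so the crossing ends with its original kind.
    TangleEquiv M [x, y, x.rev, y.rev] [] _
      [⟨[x, y], .cross c x.rev y.rev, []⟩, ⟨[x], .cap y, [x.rev]⟩, ⟨[], .cap x, []⟩] := by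
        simpa using append_right (slideCap [x] [] c.flip y x.rev)
          (v := [⟨[], .cap x, []⟩]) (C := []) (by simp)

/-- Two nested minima and a crossing beside them exchange their heights. -/
theorem cups_exchange_cross (c : Kind) (x y s t : Strand ι) :
    TangleEquiv M [s, t] [y.rev, x.rev, x, y, t, s]
      [⟨[], .cup y.rev, [s, t]⟩, ⟨[y.rev], .cup x.rev, [y, s, t]⟩,
        ⟨[y.rev, x.rev, x, y], .cross c s t, []⟩]
      [⟨[], .cross c s t, []⟩, ⟨[], .cup y.rev, [t, s]⟩, ⟨[y.rev], .cup x.rev, [y, t, s]⟩] := by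
  calc
    TangleEquiv M [s, t] [y.rev, x.rev, x, y, t, s]
      [⟨[], .cup y.rev, [s, t]⟩, ⟨[y.rev], .cup x.rev, [y, s, t]⟩,
        ⟨[y.rev, x.rev, x, y], .cross c s t, []⟩]
      [⟨[], .cup y.rev, [s, t]⟩, ⟨[y.rev, y], .cross c s t, []⟩,
        ⟨[y.rev], .cup x.rev, [y, t, s]⟩] :=
        .cons rfl (by simpa using exchange [y.rev] [y] [] (.cup x.rev) (.cross c s t))
    TangleEquiv M [s, t] [y.rev, x.rev, x, y, t, s] _
      [⟨[], .cross c s t, []⟩, ⟨[], .cup y.rev, [t, s]⟩, ⟨[y.rev], .cup x.rev, [y, t, s]⟩] := by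
        simpa using append_right (cup_exchange_cross c y.rev s t)
          (v := [⟨[y.rev], .cup x.rev, [y, t, s]⟩]) (C := [y.rev, x.rev, x, y, t, s]) (by simp)

/-- Both strands may be reversed: rotate the tangle by a half turn. -/
theorem blocks_reverse_both (hM : LocalMove.Whiskers M) {c : Kind} {x y : Strand ι}
    (h : TangleEquiv M [x, y] [x, y] (blocks [] [] n c x y) []) :
    TangleEquiv M [x.rev, y.rev] [x.rev, y.rev] (blocks [] [] n c x.rev y.rev) [] := by
  -- The half turn reverses the vertical order inside a block, so the rotated block has its virtual
  -- crossing first.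
  apply blocks_of_virt_first
  have hn := whisker hM [y.rev, x.rev] [y.rev, x.rev] h
  rw [blocks_eq_wordPow, map_whisker_wordPow] at hn
  -- Both strands are bent by nested minima and maxima. The two blocks lie on disjoint pairs of
  -- strands, so they commute by planar isotopy, and the bent strands straighten to the identity.
  refine wordPow_transfer (B := [y.rev, x.rev]) (D := [y.rev, x.rev])
    (k := [⟨[], .cup y.rev, [y.rev, x.rev]⟩, ⟨[y.rev], .cup x.rev, [y, y.rev, x.rev]⟩])
    (g := [⟨[y.rev, x.rev, x], .cap y, [x.rev]⟩, ⟨[y.rev, x.rev], .cap x, []⟩])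
    (w' := [⟨[y.rev, x.rev, x, y], .cross .virt y.rev x.rev, []⟩,
      ⟨[y.rev, x.rev, x, y], .cross c x.rev y.rev, []⟩])
    (e := []) (e' := [])
    (by simp) (by simp) (by simp) (by simp) (by simp) (by simp)
    (whisker hM [y.rev, x.rev] [] (A := [x, y, y.rev, x.rev]) (B := [x, y, y.rev, x.rev])
      (w := [⟨[], .cross c x y, [y.rev, x.rev]⟩, ⟨[], .cross .virt y x, [y.rev, x.rev]⟩,
        ⟨[x, y], .cross .virt y.rev x.rev, []⟩, ⟨[x, y], .cross c x.rev y.rev, []⟩])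
      (w' := [⟨[x, y], .cross .virt y.rev x.rev, []⟩, ⟨[x, y], .cross c x.rev y.rev, []⟩,
        ⟨[], .cross c x y, [y.rev, x.rev]⟩, ⟨[], .cross .virt y x, [y.rev, x.rev]⟩]) ?_)
    (whisker hM [y.rev, x.rev] [] (A := [x, y, y.rev, x.rev]) (B := [])
      (w := [⟨[], .cross c x y, [y.rev, x.rev]⟩, ⟨[], .cross .virt y x, [y.rev, x.rev]⟩,
        ⟨[x], .cap y, [x.rev]⟩, ⟨[], .cap x, []⟩])
      (w' := [⟨[x, y], .cross .virt y.rev x.rev, []⟩, ⟨[x, y], .cross c x.rev y.rev, []⟩,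
        ⟨[x], .cap y, [x.rev]⟩, ⟨[], .cap x, []⟩]) ?_)
    ?_ ?_ (refl rfl) hn
  · calc
      TangleEquiv M [x, y, y.rev, x.rev] [x, y, y.rev, x.rev]
        [⟨[], .cross c x y, [y.rev, x.rev]⟩, ⟨[], .cross .virt y x, [y.rev, x.rev]⟩,
          ⟨[x, y], .cross .virt y.rev x.rev, []⟩, ⟨[x, y], .cross c x.rev y.rev, []⟩]
        [⟨[], .cross c x y, [y.rev, x.rev]⟩, ⟨[y, x], .cross .virt y.rev x.rev, []⟩,
          ⟨[], .cross .virt y x, [x.rev, y.rev]⟩, ⟨[x, y], .cross c x.rev y.rev, []⟩] :=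
          .cons rfl (append_right (cross_exchange_cross _ _ _ _ _ _) (by simp))
      TangleEquiv M [x, y, y.rev, x.rev] [x, y, y.rev, x.rev] _
        [⟨[x, y], .cross .virt y.rev x.rev, []⟩, ⟨[], .cross c x y, [x.rev, y.rev]⟩,
          ⟨[], .cross .virt y x, [x.rev, y.rev]⟩, ⟨[x, y], .cross c x.rev y.rev, []⟩] :=
          append_right (cross_exchange_cross _ _ _ _ _ _) (by simp)
      TangleEquiv M [x, y, y.rev, x.rev] [x, y, y.rev, x.rev] _
        [⟨[x, y], .cross .virt y.rev x.rev, []⟩, ⟨[], .cross c x y, [x.rev, y.rev]⟩,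
          ⟨[y, x], .cross c x.rev y.rev, []⟩, ⟨[], .cross .virt y x, [y.rev, x.rev]⟩] :=
          .cons rfl (.cons rfl (cross_exchange_cross _ _ _ _ _ _))
      TangleEquiv M [x, y, y.rev, x.rev] [x, y, y.rev, x.rev] _
        [⟨[x, y], .cross .virt y.rev x.rev, []⟩, ⟨[x, y], .cross c x.rev y.rev, []⟩,
          ⟨[], .cross c x y, [y.rev, x.rev]⟩, ⟨[], .cross .virt y x, [y.rev, x.rev]⟩] :=
          .cons rfl (append_right (cross_exchange_cross _ _ _ _ _ _) (by simp))
  · calc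
      TangleEquiv M [x, y, y.rev, x.rev] []
        [⟨[], .cross c x y, [y.rev, x.rev]⟩, ⟨[], .cross .virt y x, [y.rev, x.rev]⟩,
          ⟨[x], .cap y, [x.rev]⟩, ⟨[], .cap x, []⟩]
        [⟨[], .cross c x y, [y.rev, x.rev]⟩, ⟨[y, x], .cross .virt y.rev x.rev, []⟩,
          ⟨[y], .cap x, [y.rev]⟩, ⟨[], .cap y, []⟩] :=
          .cons rfl (cross_slideCaps .virt y x)
      TangleEquiv M [x, y, y.rev, x.rev] [] _
        [⟨[x, y], .cross .virt y.rev x.rev, []⟩, ⟨[], .cross c x y, [x.rev, y.rev]⟩,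
          ⟨[y], .cap x, [y.rev]⟩, ⟨[], .cap y, []⟩] :=
          append_right (cross_exchange_cross _ _ _ _ _ _) (by simp)
      TangleEquiv M [x, y, y.rev, x.rev] [] _
        [⟨[x, y], .cross .virt y.rev x.rev, []⟩, ⟨[x, y], .cross c x.rev y.rev, []⟩,
          ⟨[x], .cap y, [x.rev]⟩, ⟨[], .cap x, []⟩] :=
          .cons rfl (cross_slideCaps c x y)
  · exact (append_right (cups_exchange_cross .virt x y y.rev x.rev)
      (v := [⟨[y.rev, x.rev, x, y], .cross c x.rev y.rev, []⟩])
      (C := [y.rev, x.rev, x, y, y.rev, x.rev]) (by simp)).trans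
      (.cons rfl (cups_exchange_cross c x y x.rev y.rev))
  · calc
      TangleEquiv M [y.rev, x.rev] [y.rev, x.rev]
        [⟨[], .cup y.rev, [y.rev, x.rev]⟩, ⟨[y.rev], .cup x.rev, [y, y.rev, x.rev]⟩,
          ⟨[y.rev, x.rev, x], .cap y, [x.rev]⟩, ⟨[y.rev, x.rev], .cap x, []⟩]
        [⟨[], .cup y.rev, [y.rev, x.rev]⟩, ⟨[y.rev], .cap y, [x.rev]⟩,
          ⟨[y.rev], .cup x.rev, [x.rev]⟩, ⟨[y.rev, x.rev], .cap x, []⟩] :=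
          .cons rfl (by
            simpa using append_right (exchange [y.rev] [] [x.rev] (.cup x.rev) (.cap y))
              (v := [⟨[y.rev, x.rev], .cap x, []⟩]) (C := [y.rev, x.rev]) (by simp))
      TangleEquiv M [y.rev, x.rev] [y.rev, x.rev] _
        [⟨[y.rev], .cup x.rev, [x.rev]⟩, ⟨[y.rev, x.rev], .cap x, []⟩] := by
          simpa using append_right (zagzig [] [x.rev] y.rev)
            (v := [⟨[y.rev], .cup x.rev, [x.rev]⟩, ⟨[y.rev, x.rev], .cap x, []⟩])
            (C := [y.rev, x.rev]) (by simp)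
      TangleEquiv M [y.rev, x.rev] [y.rev, x.rev] _ [] := by simpa using zagzig [y.rev] [] x.rev

end TangleEquiv

/-! ### Independence of crossing types and orientations -/

namespace Trivializes

variable {M : LocalMove ι} {n : ℕ} {c : Kind} {a b : Bool}

theorem swap (h : Trivializes M n c a b) : Trivializes M n c.flip b a :=
  fun i j => (h j i).blocks_swap

/-- Reversal moves the lower strand to the right of the other one; the swap restores the order and
the kind. -/
theorem reverse_under (hM : LocalMove.Whiskers M) (h : Trivializes M n .under a b) :
    Trivializes M n .under (!a) b :=
  Trivializes.swap (c := .over) fun i j => (h j i).blocks_reverse_under hM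

theorem reverse_both (hM : LocalMove.Whiskers M) (h : Trivializes M n c a b) :
    Trivializes M n c (!a) (!b) :=
  fun i j => (h i j).blocks_reverse_both hM

/-- Reversing the first strand and reversing both strands reach all four choices of directions. -/
theorem under_of_under (hM : LocalMove.Whiskers M) (h : Trivializes M n .under a b)
    (a' b' : Bool) : Trivializes M n .under a' b' := by
  have h1 := h.reverse_under hM
  have h2 := h.reverse_both hM
  have h3 := h1.reverse_both hM
  cases a <;> cases b <;> cases a' <;> cases b' <;> assumption

/-- Neither the crossing types nor the orientations matter. -/
theorem of_classical (hM : LocalMove.Whiskers M) (hc : c.IsClassical)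
    (h : Trivializes M n c a b) {c' : Kind} (hc' : c'.IsClassical) (a' b' : Bool) :
    Trivializes M n c' a' b' := by
  -- Both orders of the directions are kept, because passing from `under` to `over` by a swap also
  -- exchanges them.
  have key : Trivializes M n .under a' b' ∧ Trivializes M n .under b' a' := by
    rcases c with _ | _ | _
    · exact ⟨h.swap.under_of_under hM _ _, h.swap.under_of_under hM _ _⟩
    · exact ⟨h.under_of_under hM _ _, h.under_of_under hM _ _⟩
    · exact hc.elim
  rcases c' with _ | _ | _
  · exact key.2.swap
  · exact key.1
  · exact hc'.elim

end Trivializes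

/-! ### From tangles back to closed diagrams -/

/-- Makes every intermediate word of a chain a tangle. It is an equivalence of statements because
reflexivity also relates words that are not tangles. -/
theorem isTangle_iff_of_eqvGen {M : LocalMove ι} {A B : List (Strand ι)} {w w' : List (Slice ι)}
    (h : Relation.EqvGen (TangleStep M A B) w w') : IsTangle A w B ↔ IsTangle A w' B := by
  induction h with
  | rel _ _ h => exact iff_of_true h.1 h.2.1
  | refl => rfl
  | symm _ _ _ ih => exact ih.symm
  | trans _ _ _ _ _ ih ih' => exact ih.trans ih'

/-- Equivalent tangles may be exchanged inside of diagrams. -/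
theorem TangleEquiv.eqvGen_diagram {M : LocalMove ι} {A B : List (Strand ι)}
    {w w' below above : List (Slice ι)} (h : TangleEquiv M A B w w')
    (hb : IsTangle [] below A) (ha : IsTangle B above []) (D D' : Diagram ι)
    (hD : D.slices = below ++ w ++ above) (hD' : D'.slices = below ++ w' ++ above) :
    Relation.EqvGen (fun E E' => Step WeldedMove E E' ∨ Step M E E') D D' := by
  obtain ⟨hw, -, h⟩ := h
  induction h generalizing D D' with
  | rel w w' h =>
    obtain ⟨-, -, p, q, t, t', ht, rfl, rfl⟩ := h
    refine .rel _ _ (ht.imp ?_ ?_) <;>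
      exact fun ht => ⟨below ++ p, q ++ above, t, t', ht, by simp [hD], by simp [hD']⟩
  | refl w =>
    obtain rfl : D = D' := by
      cases D; cases D'; simp_all
    exact .refl _
  | symm w w' h ih => exact (ih D' D hD' hD ((isTangle_iff_of_eqvGen h).2 hw)).symm
  | trans w v w' h h' ih ih' =>
    have hv := (isTangle_iff_of_eqvGen h).1 hw
    -- The intermediate word closes up to a diagram between `D` and `D'`.
    exact (ih D ⟨_, (hb.append hv).append ha⟩ hD rfl hw).trans _ _ _ (ih' _ D' rfl hD' hv)

theorem realizes_blockMove {M : LocalMove ι} (hM : LocalMove.Whiskers M) {n : ℕ} (hn : 0 < n)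
    {c : Kind} {a b : Bool} (h : Trivializes M n c a b) : Realizes M (BlockMove n c a b) := by
  rintro D D' ⟨below, above, _, _, ⟨l, r, i, j⟩, hD, hD'⟩
  have h1 := D.closed
  have h2 := D'.closed
  rw [hD, isTangle_append] at h1
  rw [hD', isTangle_append] at h2
  obtain ⟨A, h1, ha⟩ := h1
  obtain ⟨B, h2, -⟩ := h2
  obtain ⟨A', hb, hw⟩ := isTangle_append.1 h1
  obtain ⟨B', hb', hw'⟩ := isTangle_append.1 h2
  obtain rfl : A' = A := hw
  obtain rfl : A' = B' := hb.top_unique hb'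
  -- The empty side of the move does not record its strands. Since `n` is positive, the first slice
  -- of the blocks shows that the strands at this height are `l`, the two strands of the move, and
  -- `r`.
  obtain ⟨m, rfl⟩ : ∃ m, n = m + 1 := ⟨n - 1, by omega⟩
  have hA : l ++ [⟨a, i⟩, ⟨b, j⟩] ++ r = A' := by
    rw [blocks_eq_wordPow, wordPow_succ] at hw'
    exact hw'.1
  subst hA
  have := (h i j).symm.whisker hM l r
  rw [map_whisker_blocks] at this
  exact TangleEquiv.eqvGen_diagram (by simpa using this) (by simpa using hb) (by simpa using ha)
    D D' hD hD'

theorem whiskers_blockMove (n : ℕ) (c : Kind) (a b : Bool) :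
    LocalMove.Whiskers (BlockMove (ι := ι) n c a b) :=
  fun l r _ _ h => h.whisker l r

theorem trivializes_blockMove (n : ℕ) (c : Kind) (a b : Bool) :
    Trivializes (BlockMove (ι := ι) n c a b) n c a b :=
  fun i j => (TangleEquiv.of_move (w := []) (.mk [] [] i j) rfl (IsTangle.wordPow (by simp) n)).symm

end Welded

theorem proposition7p6 {ι : Type*} (n : ℕ) (hn : 0 < n)
    (c c' : Welded.Kind) (hc : c.IsClassical) (hc' : c'.IsClassical) (a a' : Bool) :
    Welded.MoveEquivalent (Welded.VMove (ι := ι) n c a) (Welded.VBarMove (ι := ι) n c' a') := by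
  have hM := Welded.whiskers_blockMove (ι := ι) n
  have hT := Welded.trivializes_blockMove (ι := ι) n
  exact ⟨Welded.realizes_blockMove (hM _ _ _) hn ((hT _ _ _).of_classical (hM _ _ _) hc hc' _ _),
    Welded.realizes_blockMove (hM _ _ _) hn ((hT _ _ _).of_classical (hM _ _ _) hc' hc _ _)⟩
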